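/- All graphs are finite and simple, a class of graphs is any set of graphs, and $\mathbb{N}=\{0,1,2,\dots\}$. For $d\in\mathbb{N}$, the $d$th power $G^d$ of a graph $G$ is the graph on the vertex set of $G$ in which two distinct vertices are adjacent if and only if their distance in $G$ is at most $d$; for a class $\mathcal{C}$ put $\mathcal{C}^d=\{G^d : G\in\mathcal{C}\}$. The subchromatic number $\chi_{\mathrm{sub}}(H)$ is the least integer $c$ such that the vertices of $H$ can be colored with $c$ colors so that the subgraph induced by each color is a disjoint union of complete graphs; for a class $\mathcal{D}$ put $\chi_{\mathrm{sub}}(\mathcal{D})=\sup_{H\in\mathcal{D}}\chi_{\mathrm{sub}}(H)$. For $r\in\mathbb{N}$, a graph $H$ is a depth-$r$ minor of $G$ if it can be obtained from a subgraph of $G$ by contracting pairwise disjoint connected subgraphs of radius at most $r$; equivalently, one can assign to the vertices of $H$ pairwise vertex-disjoint connected subgraphs of $G$ of radius at most $r$ so that the subgraphs assigned to adjacent vertices of $H$ are joined by an edge of $G$. Let $\nabla_r(G)$ be the maximum of $|E(H)|/|V(H)|$, and $\omega_r(G)$ the maximum clique number, over all depth-$r$ minors $H$ of $G$. A class $\mathcal{C}$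 has bounded expansion if $\sup_{G\in\mathcal{C}}\nabla_r(G)<\infty$ for every $r\in\mathbb{N}$, and is nowhere dense if $\sup_{G\in\mathcal{C}}\omega_r(G)<\infty$ for every $r\in\mathbb{N}$. Theorem. (1) For every nowhere dense class of graphs $\mathcal{C}$, every $d\in\mathbb{N}$ and every real $\varepsilon>0$, there exists a constant $c$ such that $\chi_{\mathrm{sub}}(G^d)\le c\cdot n^{\varepsilon}$ for every $n\in\mathbb{N}$ and every $n$-vertex graph $G\in\mathcal{C}$. (2) For every class of graphs $\mathcal{C}$ with bounded expansion and every $d\in\mathbb{N}$, $\chi_{\mathrm{sub}}(\mathcal{C}^d)<\infty$. -/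

import Mathlib

open scoped ENNReal

universe u v

namespace SparsePowers

/-- A finite simple graph. -/
structure FinGraph : Type (u + 1) where
  V : Type u
  finite : Finite V
  graph : SimpleGraph V

attribute [instance] FinGraph.finite

/-- A class of graphs is a set of finite simple graphs (not necessarily closed under
isomorphism or under taking subgraphs). -/
abbrev GraphClass : Type (u + 1) := Set FinGraph.{u}

/-- The `d`-th power of `G`: distinct vertices are adjacent iff their distance in `G` is at most
`d`. The extended distance is used, so vertices in different components are at distance `⊤`. -/
def power {V : Type u} (G : SimpleGraph V) (d : ℕ) : SimpleGraph V where
  Adj a b := a ≠ b ∧ G.edist a b ≤ d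
  symm := ⟨fun a b h => ⟨h.1.symm, by rw [SimpleGraph.edist_comm]; exact h.2⟩⟩
  loopless := ⟨fun _ h => h.1 rfl⟩

/-- The `d`-th power of a finite graph. -/
def FinGraph.power (G : FinGraph.{u}) (d : ℕ) : FinGraph.{u} where
  V := G.V
  finite := G.finite
  graph := SparsePowers.power G.graph d

/-- The class of the `d`-th powers of the graphs of `C`. -/
def GraphClass.power (C : GraphClass.{u}) (d : ℕ) : GraphClass.{u} :=
  {H | ∃ G ∈ C, H = G.power d}

/-- `H` is a depth-`r` minor of `G`: there are pairwise vertex-disjoint connected subgraphs of `G`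
of radius at most `r`, one for each vertex of `H`, such that the subgraphs of adjacent vertices
of `H` are joined by an edge of `G`. (The radius of an empty or disconnected graph is `⊤`.) -/
def IsDepthMinor {W : Type v} {V : Type u} (r : ℕ) (H : SimpleGraph W) (G : SimpleGraph V) :
    Prop :=
  ∃ B : W → G.Subgraph,
    (∀ a, (B a).coe.Connected ∧ (B a).coe.radius ≤ r) ∧
    (∀ a b, a ≠ b → Disjoint (B a).verts (B b).verts) ∧
    (∀ a b, H.Adj a b → ∃ x ∈ (B a).verts, ∃ y ∈ (B b).verts, G.Adj x y)

/-- The ratio between the number of edges and the number of vertices (`0` for the null graph). -/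
noncomputable def edgeDensity (G : FinGraph.{u}) : ℝ≥0∞ :=
  (G.graph.edgeSet.ncard : ℝ≥0∞) / (Nat.card G.V : ℝ≥0∞)

/-- `∇_r(G)`: the maximum edge density among depth-`r` minors of `G`. -/
noncomputable def nabla (r : ℕ) (G : FinGraph.{u}) : ℝ≥0∞ :=
  ⨆ (H : FinGraph.{u}) (_ : IsDepthMinor r H.graph G.graph), edgeDensity H

/-- `ω_r(G)`: the largest clique number among depth-`r` minors of `G`. -/
noncomputable def omega (r : ℕ) (G : FinGraph.{u}) : ℕ∞ :=
  ⨆ (H : FinGraph.{u}) (_ : IsDepthMinor r H.graph G.graph), (H.graph.cliqueNum : ℕ∞)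

/-- `C` has bounded expansion: `∇_r(C) = sup_{G ∈ C} ∇_r(G)` is finite for every `r`. -/
def BoundedExpansion (C : GraphClass.{u}) : Prop :=
  ∀ r : ℕ, (⨆ G ∈ C, nabla r G) < ⊤

/-- `C` is nowhere dense: `ω_r(C) = sup_{G ∈ C} ω_r(G)` is finite for every `r`. -/
def NowhereDense (C : GraphClass.{u}) : Prop :=
  ∀ r : ℕ, (⨆ G ∈ C, omega r G) < ⊤

/-- A disjoint union of complete graphs: every connected component is a clique. -/
def IsClusterGraph {V : Type u} (G : SimpleGraph V) : Prop :=
  ∀ K : G.ConnectedComponent, G.IsClique K.supp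

/-- The vertices of `G` can be coloured with `c` colours so that each colour induces a disjoint
union of complete graphs. -/
def SubColorable {V : Type u} (G : SimpleGraph V) (c : ℕ) : Prop :=
  ∃ f : V → Fin c, ∀ i : Fin c, IsClusterGraph (G.induce {v | f v = i})

/-- The subchromatic number `χ_sub(G)` of a finite graph: the least `c` such that the vertices can
be coloured with `c` colours, each inducing a disjoint union of complete graphs. -/
noncomputable def chiSub (G : FinGraph.{u}) : ℕ := sInf {c : ℕ | SubColorable G.graph c}

/-- The set in the definition of `chiSub` is nonempty, so the least element exists. -/
theorem exists_subColorable (G : FinGraph.{u}) : ∃ c : ℕ, SubColorable G.graph c := by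
  refine ⟨Nat.card G.V, Finite.equivFin G.V, fun i K a _ b _ hab => ?_⟩
  exact absurd (Subtype.ext ((Finite.equivFin G.V).injective (a.2.trans b.2.symm))) hab

theorem subColorable_chiSub (G : FinGraph.{u}) : SubColorable G.graph (chiSub G) :=
  Nat.sInf_mem (exists_subColorable G)

/-- `χ_sub(C) = sup_{G ∈ C} χ_sub(G)`. -/
noncomputable def chiSubClass (C : GraphClass.{u}) : ℕ∞ := ⨆ G ∈ C, (chiSub G : ℕ∞)

end SparsePowers

/-! The argument goes through weak colouring numbers. Order the vertices so that few vertices are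
weakly `2d`-reachable from each vertex, and colour greedily so that every vertex differs from those
it weakly `2d`-reaches. Give each vertex the colour of the least vertex in its ball of radius
`⌊d/2⌋`, its centre. If two vertices adjacent in the power have different centres, the lower centre
is weakly reachable from the higher, so their colours differ. Hence a component of a colour class
has a single centre and diameter at most `d` in `G`, and is a clique of the power
(`subColorable_power`).

The ordering comes from sparsity of shallow minors. If every depth-`r` minor on `n'` vertices has at
most `s * n'` edges, each nonempty set `S` contains a vertex that a set of size polynomial in `s`
separates from the rest of `S` along walks of length at most `r` (`exists_hits`). Removing such
vertices one at a time, last rank first, gives the order, and iterating the separation bounds weak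
reachability (`ncard_weakReach_le`).

For bounded expansion `s` is a constant. For nowhere dense classes `s` may be taken of order `n ^
ε`: a dense graph without large shallow clique minors has a depth-1 minor of comparable density on
far fewer vertices (`exists_smaller_dense_minor`). Since density never exceeds the number of
vertices, iteration bounds every power of the density by a constant times the number of vertices
(`RootedMinor.density_pow_le`). -/

namespace SparsePowers

/-! ### Walks confined to a set of vertices. -/

/-- Some walk of length at most `n` from `a` to `b` has all its vertices in `P`. -/
def WalkIn {V : Type u} (G : SimpleGraph V) (P : V → Prop) (n : ℕ) (a b : V) : Prop :=
  ∃ p : G.Walk a b, p.length ≤ n ∧ ∀ x ∈ p.support, P x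

namespace WalkIn

variable {V : Type u} {G : SimpleGraph V} {P Q : V → Prop} {m n : ℕ} {a b c : V}

theorem refl (ha : P a) : WalkIn G P n a a :=
  ⟨.nil, by simp, by simpa using ha⟩

theorem mono (h : WalkIn G P m a b) (hmn : m ≤ n) (hPQ : ∀ x, P x → Q x) : WalkIn G Q n a b := by
  obtain ⟨p, hp, hx⟩ := h
  exact ⟨p, hp.trans hmn, fun x h => hPQ x (hx x h)⟩

theorem trans (h : WalkIn G P m a b) (h' : WalkIn G P n b c) : WalkIn G P (m + n) a c := by
  obtain ⟨p, hp, hx⟩ := h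
  obtain ⟨q, hq, hy⟩ := h'
  refine ⟨p.append q, by rw [SimpleGraph.Walk.length_append]; omega, fun x h => ?_⟩
  rw [SimpleGraph.Walk.mem_support_append_iff] at h
  exact h.elim (hx x) (hy x)

theorem symm (h : WalkIn G P n a b) : WalkIn G P n b a := by
  obtain ⟨p, hp, hx⟩ := h
  exact ⟨p.reverse, by simpa using hp, fun x h => hx x (by simpa using h)⟩

theorem left (h : WalkIn G P n a b) : P a := by
  obtain ⟨p, -, hx⟩ := h
  exact hx a p.start_mem_support

theorem right (h : WalkIn G P n a b) : P b := h.symm.left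

theorem adj (h : G.Adj a b) (ha : P a) (hb : P b) : WalkIn G P 1 a b :=
  ⟨h.toWalk, by simp, by simp [ha, hb]⟩

theorem step (h : WalkIn G P n a b) (hbc : G.Adj b c) (hc : P c) : WalkIn G P (n + 1) a c :=
  h.trans (adj hbc h.right hc)

/-- The vertices of the walk are themselves reachable inside `P`. -/
theorem strengthen (h : WalkIn G P n a b) : WalkIn G (fun x => WalkIn G P n a x) n a b := by
  classical
  obtain ⟨p, hp, hx⟩ := h
  refine ⟨p, hp, fun x h => ⟨p.takeUntil x h, (p.length_takeUntil_le_length h).trans hp,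
    fun y hy => hx y (p.support_takeUntil_subset_support h hy)⟩⟩

end WalkIn

/-! ### Shallow minors encoded as partial labellings of the vertices. -/

/-- `H` is a depth-`r` minor of `G` whose vertices are the elements of `S ⊆ V(G)`: the branch set of
`a ∈ S` consists of the vertices with label `some a`, and it has radius at most `r` around `a`. -/
structure RootedMinor {V : Type u} (G : SimpleGraph V) (r : ℕ) (S : Finset V) (H : SimpleGraph V)
    (φ : V → Option V) : Prop where
  root : ∀ a ∈ S, φ a = some a
  mem : ∀ v a, φ v = some a → a ∈ S
  reach : ∀ v a, φ v = some a → WalkIn G (fun x => φ x = some a) r a v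
  left_mem : ∀ a b, H.Adj a b → a ∈ S
  edge : ∀ a b, H.Adj a b → ∃ x y, φ x = some a ∧ φ y = some b ∧ G.Adj x y

variable {V : Type u} {G H : SimpleGraph V} {r s : ℕ} {S T : Finset V} {φ : V → Option V}

theorem RootedMinor.mono (h : RootedMinor G r S H φ) (hrs : r ≤ s) : RootedMinor G s S H φ :=
  ⟨h.root, h.mem, fun v a hv => (h.reach v a hv).mono hrs fun _ => id, h.left_mem, h.edge⟩

theorem RootedMinor.right_mem (h : RootedMinor G r S H φ) {a b : V} (hab : H.Adj a b) : b ∈ S :=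
  h.left_mem b a hab.symm

/-- Walks of a minor lift to walks of the graph. -/
theorem RootedMinor.lift (h : RootedMinor G r S H φ) {P : V → Prop} {n : ℕ} {a b : V}
    (ha : a ∈ S) (hw : WalkIn H P n a b) :
    WalkIn G (fun x => ∃ c, φ x = some c ∧ P c) (n * (2 * r + 1)) a b := by
  obtain ⟨p, hp, hx⟩ := hw
  induction p generalizing n with
  | nil => exact .refl ⟨_, h.root _ ha, hx _ (by simp)⟩
  | @cons a c b hac p ih =>
    obtain ⟨n, rfl⟩ : ∃ k, n = k + 1 := ⟨n - 1, by simp at hp; omega⟩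
    have h1 := ih (n := n) (h.right_mem hac) (by simpa using hp) fun x hx' => hx x (by simp [hx'])
    have hPa : P a := hx a (by simp)
    have hPc : P c := hx c (by simp)
    obtain ⟨x, y, hxa, hyc, hxy⟩ := h.edge a c hac
    have h2 : WalkIn G (fun x => ∃ c, φ x = some c ∧ P c) r a x :=
      (h.reach x a hxa).mono le_rfl fun z hz => ⟨a, hz, hPa⟩
    have h3 : WalkIn G (fun x => ∃ c, φ x = some c ∧ P c) r c y :=
      (h.reach y c hyc).mono le_rfl fun z hz => ⟨c, hz, hPc⟩
    -- Each edge of the minor costs at most `r` to leave one branch set, `1` to cross, and `r` to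
    -- reach the next root.
    exact (((h2.step hxy ⟨c, hyc, hPc⟩).trans h3.symm).trans h1).mono
      (le_of_eq (by ring)) fun _ => id

/-- A walk of length `s` from the root lifts to length `s * (2 * r + 1)`; the final `r` descends
inside the last branch set. -/
theorem RootedMinor.comp (h : RootedMinor G r S H φ) {H' : SimpleGraph V} {ψ : V → Option V}
    (h' : RootedMinor H s T H' ψ) (hTS : T ⊆ S) :
    RootedMinor G (s * (2 * r + 1) + r) T H' (fun z => (φ z).bind ψ) where
  root a ha := by simp [h.root a (hTS ha), h'.root a ha]
  mem v a hv := by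
    obtain ⟨b, hb, hba⟩ := Option.bind_eq_some_iff.1 hv
    exact h'.mem b a hba
  reach v a hv := by
    obtain ⟨b, hb, hba⟩ := Option.bind_eq_some_iff.1 hv
    have h1 := h.lift (hTS (h'.mem b a hba)) (h'.reach b a hba)
    have h2 := h.reach v b hb
    refine (h1.mono le_rfl ?_).trans (h2.mono le_rfl ?_)
    · rintro x ⟨c, hc, hca⟩
      simp [hc, hca]
    · intro x hx
      simp [hx, hba]
  left_mem := h'.left_mem
  edge a b hab := by
    obtain ⟨x, y, hx, hy, hxy⟩ := h'.edge a b hab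
    obtain ⟨x', y', hx', hy', hxy'⟩ := h.edge x y hxy
    exact ⟨x', y', by simp [hx', hx], by simp [hy', hy], hxy'⟩

/-- The part of `H` inside `T`, on the same vertex type. -/
def restrict (H : SimpleGraph V) (T : Finset V) : SimpleGraph V where
  Adj a b := H.Adj a b ∧ a ∈ T ∧ b ∈ T
  symm := ⟨fun _ _ h => ⟨h.1.symm, h.2.2, h.2.1⟩⟩
  loopless := ⟨fun _ h => h.1.ne rfl⟩

open Classical in
theorem rootedMinor_restrict (H : SimpleGraph V) (T : Finset V) :
    RootedMinor H 0 T (restrict H T) (fun z => if z ∈ T then some z else none) where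
  root a ha := by simp [ha]
  mem v a := by
    split_ifs with hv
    · rintro ⟨⟩; exact hv
    · simp
  reach v a hv := by
    split_ifs at hv with h
    cases hv
    exact .refl (by simp [h])
  left_mem a b h := h.2.1
  edge a b h := ⟨a, b, by simp [h.2.1], by simp [h.2.2], h.1⟩

theorem RootedMinor.exists_restrict (h : RootedMinor G r S H φ) (hTS : T ⊆ S) :
    ∃ ψ, RootedMinor G r T (restrict H T) ψ :=
  ⟨_, (h.comp (rootedMinor_restrict H T) hTS).mono (by simp)⟩

/-- The cut is made after `r` steps, or at the last edge if the path is too short for that;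
truncated subtraction covers the second case. With length at most `2 * r + 1` both pieces have
length at most `r`. -/
theorem exists_split_path {a b : V} (p : G.Walk a b) (hp : p.IsPath) (hab : a ≠ b) (r : ℕ) :
    ∃ (x y : V) (q : G.Walk a x) (q' : G.Walk y b), G.Adj x y ∧ q.length ≤ r ∧
      q'.length ≤ p.length - (r + 1) ∧ p.support = q.support ++ q'.support := by
  induction p generalizing r with
  | nil => exact absurd rfl hab
  | @cons a c b hac p ih =>
    rcases r with _ | r
    · exact ⟨a, c, .nil, p, hac, by simp, by simp, by simp⟩
    · by_cases hcb : c = b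
      · subst hcb
        obtain rfl := SimpleGraph.Walk.eq_nil_iff_nil.2 (SimpleGraph.Walk.isPath_iff_nil.1 hp.of_cons)
        exact ⟨a, c, .nil, .nil, hac, by simp, by simp, by simp⟩
      · obtain ⟨x, y, q, q', hxy, hq, hq', hs⟩ := ih hp.of_cons hcb r
        exact ⟨x, y, .cons hac q, q', hxy, by simpa using hq, by simpa using hq', by simp [hs]⟩

/-- A minor can be extended by an edge along a short path with unlabelled interior. -/
theorem RootedMinor.extend (h : RootedMinor G r S H φ) {a b : V} (ha : a ∈ S) (hb : b ∈ S)
    (hab : a ≠ b) (p : G.Walk a b) (hp : p.IsPath) (hlen : p.length ≤ 2 * r + 1)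
    (hφ : ∀ z ∈ p.support, z = a ∨ z = b ∨ φ z = none) :
    ∃ ψ, RootedMinor G r S (H ⊔ SimpleGraph.edge a b) ψ ∧
      ∀ z, ψ z ≠ none → φ z ≠ none ∨ z ∈ p.support := by
  classical
  obtain ⟨x, y, q, q', hxy, hq, hq', hs⟩ := exists_split_path p hp hab r
  have hnd := hp.support_nodup
  rw [hs, List.nodup_append] at hnd
  have hdis : ∀ z ∈ q.support, z ∉ q'.support := fun z hz hz' => hnd.2.2 z hz z hz' rfl
  have hq1 : ∀ z ∈ q.support, z = a ∨ φ z = none := fun z hz => by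
    rcases hφ z (by simp [hs, hz]) with h | h | h
    · exact .inl h
    · exact absurd q'.end_mem_support (h ▸ hdis z hz)
    · exact .inr h
  have hq2 : ∀ z ∈ q'.support, z = b ∨ φ z = none := fun z hz => by
    rcases hφ z (by simp [hs, hz]) with h | h | h
    · exact absurd hz (hdis z (h ▸ q.start_mem_support))
    · exact .inl h
    · exact .inr h
  obtain ⟨ψ, hψ⟩ : ∃ ψ : V → Option V, ψ = fun z => if z ∈ q.support then some a else
    if z ∈ q'.support then some b else φ z := ⟨_, rfl⟩
  have hψ1 : ∀ z ∈ q.support, ψ z = some a := fun z hz => by simp [hψ, hz]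
  have hψ2 : ∀ z ∈ q'.support, ψ z = some b := fun z hz => by
    have : z ∉ q.support := fun h' => hdis z h' hz
    simp [hψ, hz, this]
  have hmono : ∀ z c, φ z = some c → ψ z = some c := fun z c hz => by
    by_cases h1 : z ∈ q.support
    · rw [hψ1 z h1]
      rcases hq1 z h1 with rfl | h'
      · rw [← hz, h.root z ha]
      · simp [h'] at hz
    by_cases h2 : z ∈ q'.support
    · rw [hψ2 z h2]
      rcases hq2 z h2 with rfl | h'
      · rw [← hz, h.root z hb]
      · simp [h'] at hz
    simp [hψ, h1, h2, hz]
  have hcases : ∀ z c, ψ z = some c → (z ∈ q.support ∧ c = a) ∨ (z ∈ q'.support ∧ c = b) ∨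
      φ z = some c := fun z c hz => by
    by_cases h1 : z ∈ q.support
    · rw [hψ1 z h1] at hz
      exact .inl ⟨h1, (Option.some.inj hz).symm⟩
    by_cases h2 : z ∈ q'.support
    · rw [hψ2 z h2] at hz
      exact .inr (.inl ⟨h2, (Option.some.inj hz).symm⟩)
    simp only [hψ, h1, h2, if_false] at hz
    exact .inr (.inr hz)
  refine ⟨ψ, ⟨fun c hc => hmono c c (h.root c hc), ?_, ?_, ?_, ?_⟩, ?_⟩
  · intro v c hv
    rcases hcases v c hv with ⟨-, rfl⟩ | ⟨-, rfl⟩ | hv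
    exacts [ha, hb, h.mem v c hv]
  · intro v c hv
    rcases hcases v c hv with ⟨hz, rfl⟩ | ⟨hz, rfl⟩ | hv
    · exact ⟨q.takeUntil v hz, (q.length_takeUntil_le_length hz).trans hq,
        fun w hw => hψ1 w (q.support_takeUntil_subset_support hz hw)⟩
    · have hw : WalkIn G (fun x => ψ x = some c) r v c :=
        ⟨q'.dropUntil v hz, (q'.length_dropUntil_le_length hz).trans (by omega),
          fun w hw => hψ2 w (q'.support_dropUntil_subset_support hz hw)⟩
      exact hw.symm
    · exact (h.reach v c hv).mono le_rfl fun z hz => hmono z c hz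
  · rintro c d (hcd | hcd)
    · exact h.left_mem c d hcd
    · rw [SimpleGraph.edge_adj] at hcd
      rcases hcd.1 with ⟨rfl, rfl⟩ | ⟨rfl, rfl⟩ <;> assumption
  · rintro c d (hcd | hcd)
    · obtain ⟨x, y, hx, hy, hxy⟩ := h.edge c d hcd
      exact ⟨x, y, hmono _ _ hx, hmono _ _ hy, hxy⟩
    · rw [SimpleGraph.edge_adj] at hcd
      have hx := hψ1 x q.end_mem_support
      have hy := hψ2 y q'.start_mem_support
      rcases hcd.1 with ⟨rfl, rfl⟩ | ⟨rfl, rfl⟩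
      exacts [⟨x, y, hx, hy, hxy⟩, ⟨y, x, hy, hx, hxy.symm⟩]
  · intro z hz
    by_cases h1 : z ∈ p.support
    · exact .inr h1
    · rw [hs, List.mem_append, not_or] at h1
      simp only [hψ, h1.1, h1.2, if_false] at hz
      exact .inl hz

/-! ### Saturated minors and independent sets in them. -/

theorem ncard_edgeSet_sup_edge [Finite V] (H : SimpleGraph V) {a b : V} (hab : a ≠ b)
    (h : ¬ H.Adj a b) : (H ⊔ SimpleGraph.edge a b).edgeSet.ncard = H.edgeSet.ncard + 1 := by
  rw [SimpleGraph.edgeSet_sup, SimpleGraph.edgeSet_edge_of_ne hab, Set.union_singleton,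
    Set.ncard_insert_of_notMem (by simpa using h)]

/-- A minor with vertex set `S` that cannot be extended along short paths, and that uses at most
`m` vertices outside `S` for each of its edges. -/
theorem exists_saturated_rootedMinor [Finite V] (G : SimpleGraph V) (S : Finset V) {r m : ℕ}
    (hm : m ≤ 2 * r) :
    ∃ H φ, RootedMinor G r S H φ ∧ {z | φ z ≠ none ∧ z ∉ S}.ncard ≤ m * H.edgeSet.ncard ∧
      ∀ a ∈ S, ∀ b ∈ S, a ≠ b →
        WalkIn G (fun z => z = a ∨ z = b ∨ φ z = none) (m + 1) a b → H.Adj a b := by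
  classical
  -- The number of edges is maximised subject to the budget of `m` labelled outside vertices per
  -- edge. A path of length at most `m + 1` has at most `m` interior vertices, so adding it stays
  -- within budget and contradicts maximality.
  obtain ⟨⟨H, φ⟩, ⟨h, hc⟩, hmax⟩ := Set.exists_max_image
    {x : SimpleGraph V × (V → Option V) | RootedMinor G r S x.1 x.2 ∧
      {z | x.2 z ≠ none ∧ z ∉ S}.ncard ≤ m * x.1.edgeSet.ncard}
    (fun x => x.1.edgeSet.ncard) (Set.toFinite _)
    ⟨(⊥, fun z => if z ∈ S then some z else none), by
      refine ⟨⟨fun a ha => by simp [ha], ?_, ?_, by simp, by simp⟩, ?_⟩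
      · exact (rootedMinor_restrict ⊥ S).mem
      · exact fun v a hv => ((rootedMinor_restrict G S).reach v a hv).mono (Nat.zero_le _)
          fun _ => id
      · simp⟩
  dsimp only at h hc
  refine ⟨H, φ, h, hc, fun a ha b hb hab hw => ?_⟩
  by_contra hadj
  obtain ⟨p, hp, hz⟩ := hw
  have hlen : p.bypass.length ≤ m + 1 := p.length_bypass_le_length.trans hp
  obtain ⟨ψ, hψ, hψ'⟩ := h.extend ha hb hab p.bypass p.bypass_isPath (by omega)
    fun z hz' => hz z (p.support_bypass_subset_support hz')
  have hsub : {z | ψ z ≠ none ∧ z ∉ S} ⊆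
      {z | φ z ≠ none ∧ z ∉ S} ∪ ↑((p.bypass.support.toFinset.erase a).erase b) := by
    rintro z ⟨hz1, hz2⟩
    rcases hψ' z hz1 with hz3 | hz3
    · exact .inl ⟨hz3, hz2⟩
    · refine .inr ?_
      have h1 : z ≠ a := fun h => hz2 (h ▸ ha)
      have h2 : z ≠ b := fun h => hz2 (h ▸ hb)
      simp [h1, h2, hz3]
  have hcard : ((p.bypass.support.toFinset.erase a).erase b).card ≤ m := by
    rw [Finset.card_erase_of_mem (by simp [hab.symm]), Finset.card_erase_of_mem (by simp)]
    have := p.bypass.support.toFinset_card_le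
    rw [SimpleGraph.Walk.length_support] at this
    omega
  have hE := ncard_edgeSet_sup_edge H hab hadj
  have := hmax (H ⊔ SimpleGraph.edge a b, ψ) ⟨hψ, by
    have h1 := Set.ncard_le_ncard hsub (Set.toFinite _)
    have h2 := Set.ncard_union_le {z | φ z ≠ none ∧ z ∉ S}
      ↑((p.bypass.support.toFinset.erase a).erase b)
    rw [Set.ncard_coe_finset] at h2
    simp only [hE, mul_add]
    omega⟩
  simp only [hE] at this
  omega

theorem exists_ncard_neighborSet_le [Finite V] (hT : T.Nonempty)
    (hs : H.edgeSet.ncard ≤ s * T.card) : ∃ v ∈ T, (H.neighborSet v).ncard ≤ 2 * s := by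
  classical
  have := Fintype.ofFinite V
  have h1 := H.sum_degrees_eq_twice_card_edges
  rw [← SimpleGraph.coe_edgeFinset, Set.ncard_coe_finset] at hs
  by_contra! h
  have h2 : ∑ v ∈ T, H.degree v ≤ ∑ v, H.degree v :=
    Finset.sum_le_sum_of_subset (Finset.subset_univ _)
  have h3 : T.card • (2 * s + 1) ≤ ∑ v ∈ T, H.degree v := by
    refine Finset.card_nsmul_le_sum _ _ _ fun v hv => ?_
    have := h v hv
    rw [← SimpleGraph.coe_neighborFinset, Set.ncard_coe_finset,
      SimpleGraph.card_neighborFinset_eq_degree] at this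
    omega
  have h4 := hT.card_pos
  rw [smul_eq_mul] at h3
  nlinarith

/-- Restrictions of a minor are minors, hence sparse, so a vertex of degree at most `2 * s` is
always available. Choosing it greedily discards at most `2 * s + 1` vertices. -/
theorem RootedMinor.exists_independent [Finite V]
    (hd : ∀ S H φ, RootedMinor G r S H φ → H.edgeSet.ncard ≤ s * S.card)
    (h : RootedMinor G r S H φ) :
    ∃ I ⊆ S, (∀ a ∈ I, ∀ b ∈ I, ¬ H.Adj a b) ∧ S.card ≤ (2 * s + 1) * I.card := by
  classical
  suffices ∀ T ⊆ S, ∃ I ⊆ T, (∀ a ∈ I, ∀ b ∈ I, ¬ H.Adj a b) ∧ T.card ≤ (2 * s + 1) * I.card from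
    this S subset_rfl
  intro T
  induction T using Finset.strongInduction with
  | H T ih =>
    intro hTS
    rcases T.eq_empty_or_nonempty with rfl | hT
    · exact ⟨∅, by simp⟩
    obtain ⟨ψ, hψ⟩ := h.exists_restrict hTS
    obtain ⟨v, hv, hdeg⟩ := exists_ncard_neighborSet_le hT (hd _ _ _ hψ)
    obtain ⟨N, hN⟩ := ((restrict H T).neighborSet v).toFinite.exists_finset_coe
    rw [← hN, Set.ncard_coe_finset] at hdeg
    have hN' : ∀ w ∈ T, H.Adj v w → w ∈ N := fun w hw hvw => by
      rw [← Finset.mem_coe, hN]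
      exact ⟨hvw, hv, hw⟩
    have hsub : (T \ N).erase v ⊆ T := (Finset.erase_subset _ _).trans Finset.sdiff_subset
    obtain ⟨I, hI, hind, hcard⟩ := ih ((T \ N).erase v)
      ⟨hsub, fun hle => by simpa using hle hv⟩ (hsub.trans hTS)
    have hvI : v ∉ I := fun hvI => by simpa using hI hvI
    have hvn : ∀ w ∈ I, ¬ H.Adj v w := fun w hw hvw => by
      have := hI hw
      simp only [Finset.mem_erase, Finset.mem_sdiff] at this
      exact this.2.2 (hN' w this.2.1 hvw)
    refine ⟨insert v I, Finset.insert_subset hv (hI.trans hsub), ?_, ?_⟩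
    · intro a ha b hb hab
      rw [Finset.mem_insert] at ha hb
      rcases ha with rfl | ha <;> rcases hb with rfl | hb
      · exact hab.ne rfl
      · exact hvn b hb hab
      · exact hvn a ha hab.symm
      · exact hind a ha b hb hab
    · rw [Finset.card_insert_of_notMem hvI]
      have h1 := Finset.le_card_sdiff N T
      have h2 := Finset.pred_card_le_card_erase (s := T \ N) (a := v)
      have h3 : (2 * s + 1) * (I.card + 1) = (2 * s + 1) * I.card + (2 * s + 1) := by ring
      omega

/-! ### Small sets separating a vertex from the rest of a set. -/

/-- `X` meets every walk of length at most `n` from `v` to another vertex of `S`. -/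
def Hits (G : SimpleGraph V) (n : ℕ) (S : Set V) (v : V) (X : Finset V) : Prop :=
  v ∉ X ∧ ∀ u ∈ S, u ≠ v → ∀ p : G.Walk v u, p.length ≤ n → ∃ x ∈ X, x ∈ p.support

/-- A walk from `v` that reaches `M ∖ {v}` does so along an edge that leaves the set of vertices
reachable from `v` outside `M`. -/
theorem exists_exit {M : Set V} {v a u : V} {m n : ℕ}
    (ha : WalkIn G (fun z => z = v ∨ z ∉ M) m v a) (p : G.Walk a u) (hp : m + p.length ≤ n)
    (hu : u ∈ M) (huv : u ≠ v) :
    ∃ w ∈ p.support, w ∈ M ∧ w ≠ v ∧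
      ∃ x, WalkIn G (fun z => z = v ∨ z ∉ M) n v x ∧ G.Adj x w := by
  induction p generalizing m with
  | nil => exact absurd ha.right (by simp [hu, huv])
  | @cons a b c hab p ih =>
    rw [SimpleGraph.Walk.length_cons] at hp
    by_cases hb : b = v ∨ b ∉ M
    · obtain ⟨w, hw, h⟩ := ih (ha.step hab hb) (by omega) hu huv
      exact ⟨w, by simp [hw], h⟩
    · push Not at hb
      exact ⟨b, by simp, hb.2, hb.1, a, ha.mono (by omega) fun _ => id, hab⟩

/-- Take a saturated minor on `S`, its labelled set `M`, and an independent `I ⊆ S`. By saturation,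
the `r`-balls around the vertices of `I` that avoid `M` are disjoint, and contracting them gives a
minor on `M` joining each `v ∈ I` to its boundary `N v ⊆ M`. Sparsity of this second minor makes
some `N v` small. The three factors of the bound are the density `s`, the ratio `|M| / |S|` and the
ratio `|S| / |I|`. -/
theorem exists_hits [Finite V]
    (hd : ∀ S H φ, RootedMinor G r S H φ → H.edgeSet.ncard ≤ s * S.card) (hS : S.Nonempty) :
    ∃ v ∈ S, ∃ X, Hits G r S v X ∧ X.card ≤ s * (1 + 2 * r * s) * (2 * s + 1) := by
  classical
  obtain ⟨H, φ, h, hM, hsat⟩ := exists_saturated_rootedMinor G S (le_refl (2 * r))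
  obtain ⟨I, hIS, hI, hSI⟩ := h.exists_independent hd
  obtain ⟨M, hMφ⟩ := (Set.toFinite {z | φ z ≠ none}).exists_finset_coe
  have hmemM : ∀ z, z ∈ M ↔ φ z ≠ none := fun z => by rw [← Finset.mem_coe, hMφ]; rfl
  have hSM : S ⊆ M := fun a ha => by simp [hmemM, h.root a ha]
  have hMcard : M.card ≤ (1 + 2 * r * s) * S.card := by
    have h1 : {z | φ z ≠ none ∧ z ∉ S} = ↑(M \ S) := by ext z; simp [hmemM]
    rw [h1, Set.ncard_coe_finset, Finset.card_sdiff_of_subset hSM] at hM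
    have h2 := Nat.mul_le_mul_left (2 * r) (hd _ _ _ h)
    have h3 : (1 + 2 * r * s) * S.card = S.card + 2 * r * (s * S.card) := by ring
    omega
  let B : V → V → Prop := fun v x => WalkIn G (fun z => z = v ∨ z ∉ M) r v x
  let N : V → Finset V := fun v => M.filter fun w => w ≠ v ∧ ∃ x, B v x ∧ G.Adj x w
  have hNmem : ∀ v w, w ∈ N v ↔ w ∈ M ∧ w ≠ v ∧ ∃ x, B v x ∧ G.Adj x w := fun v w => by
    simp [N]
  have hBS : ∀ v x, B v x → x ≠ v → x ∉ M := fun v x hx hxv => hx.right.resolve_left hxv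
  have hconn : ∀ v ∈ I, ∀ w ∈ I, v ≠ w →
      ¬ WalkIn G (fun z => z = v ∨ z = w ∨ z ∉ M) (2 * r + 1) v w := by
    intro v hv w hw hvw hwalk
    exact hI v hv w hw (hsat v (hIS hv) w (hIS hw) hvw
      (hwalk.mono le_rfl fun z => by simp [hmemM]))
  have hdisj : ∀ v ∈ I, ∀ w ∈ I, ∀ x, B v x → B w x → v = w := by
    intro v hv w hw x hx hy
    by_contra hvw
    have h1 : WalkIn G (fun z => z = v ∨ z = w ∨ z ∉ M) r v x := hx.mono le_rfl fun z => by tauto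
    have h2 : WalkIn G (fun z => z = v ∨ z = w ∨ z ∉ M) r w x := hy.mono le_rfl fun z => by tauto
    exact hconn v hv w hw hvw ((h1.trans h2.symm).mono (by omega) fun _ => id)
  have hNI : ∀ v ∈ I, ∀ w ∈ N v, w ∉ I := by
    intro v hv w hw hwI
    obtain ⟨-, hwv, x, hx, hxw⟩ := (hNmem v w).1 hw
    have h1 : WalkIn G (fun z => z = v ∨ z = w ∨ z ∉ M) r v x := hx.mono le_rfl fun z => by tauto
    have h2 := h1.step hxw (.inr (.inl rfl))
    exact hconn v hv w hwI hwv.symm (h2.mono (by omega) fun _ => id)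
  suffices ∃ v ∈ I, (N v).card ≤ s * (1 + 2 * r * s) * (2 * s + 1) by
    obtain ⟨v, hv, hcard⟩ := this
    refine ⟨v, hIS hv, N v, ⟨by simp [hNmem], fun u hu huv p hp => ?_⟩, hcard⟩
    obtain ⟨w, hw, hwM, hwv, x, hx, hxw⟩ := exists_exit (M := (M : Set V)) (n := r)
      (.refl (n := 0) (.inl rfl)) p (by omega) (hSM hu) huv
    exact ⟨w, (hNmem v w).2 ⟨hwM, hwv, x, hx, hxw⟩, hw⟩
  by_contra! hbig
  -- The second minor: vertices of `M` keep their own label, and each ball is absorbed into its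
  -- centre.
  let H' : SimpleGraph V := SimpleGraph.fromRel fun a b => a ∈ I ∧ b ∈ N a
  have hH' : ∀ a b, H'.Adj a b ↔ a ≠ b ∧ ((a ∈ I ∧ b ∈ N a) ∨ (b ∈ I ∧ a ∈ N b)) :=
    fun a b => SimpleGraph.fromRel_adj _ a b
  let ψ : V → Option V := fun z => if z ∈ M then some z else
    if hz : ∃ v ∈ I, B v z then some hz.choose else none
  have hψM : ∀ z ∈ M, ψ z = some z := fun z hz => by simp [ψ, hz]
  have hψB : ∀ v ∈ I, ∀ z, B v z → ψ z = some v := by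
    intro v hv z hz
    by_cases hzv : z = v
    · rw [hzv, hψM v (hSM (hIS hv))]
    · have hex : ∃ v ∈ I, B v z := ⟨v, hv, hz⟩
      have h1 := hex.choose_spec
      simp only [ψ, hBS v z hz hzv, if_false, dif_pos hex]
      rw [hdisj _ h1.1 v hv z h1.2 hz]
  have hψ : ∀ z v, ψ z = some v → (z ∈ M ∧ z = v) ∨ (v ∈ I ∧ B v z) := by
    intro z v
    by_cases hz : z ∈ M
    · rw [hψM z hz]
      rintro ⟨⟩
      exact .inl ⟨hz, rfl⟩
    · by_cases hex : ∃ v ∈ I, B v z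
      · obtain ⟨w, hw, hwz⟩ := hex
        rw [hψB w hw z hwz]
        rintro ⟨⟩
        exact .inr ⟨hw, hwz⟩
      · simp [ψ, hz, hex]
  have hminor : RootedMinor G r M H' ψ := by
    refine ⟨hψM, ?_, ?_, ?_, ?_⟩
    · intro z v hz
      rcases hψ z v hz with ⟨h1, rfl⟩ | ⟨h1, -⟩
      exacts [h1, hSM (hIS h1)]
    · intro z v hz
      rcases hψ z v hz with ⟨h1, rfl⟩ | ⟨h1, h2⟩
      · exact .refl hz
      · exact h2.strengthen.mono le_rfl fun x hx => hψB v h1 x hx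
    · intro a b hab
      rcases ((hH' a b).1 hab).2 with ⟨h1, -⟩ | ⟨-, h1⟩
      exacts [hSM (hIS h1), ((hNmem _ _).1 h1).1]
    · intro a b hab
      rcases ((hH' a b).1 hab).2 with ⟨h1, h2⟩ | ⟨h1, h2⟩ <;>
        obtain ⟨hm, -, x, hx, hxw⟩ := (hNmem _ _).1 h2
      · exact ⟨x, b, hψB a h1 x hx, hψM b hm, hxw⟩
      · exact ⟨a, x, hψM a hm, hψB b h1 x hx, hxw.symm⟩
  -- No edge is counted from both ends, because `N v` is disjoint from `I`.
  have hcount : (I.sigma N).card ≤ H'.edgeSet.ncard := by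
    rw [← Set.ncard_coe_finset]
    refine Set.ncard_le_ncard_of_injOn (fun x => s(x.1, x.2)) ?_ ?_ (Set.toFinite _)
    · rintro ⟨a, b⟩ hab
      simp only [Finset.coe_sigma, Set.mem_sigma_iff, Finset.mem_coe] at hab
      exact (hH' a b).2 ⟨((hNmem a b).1 hab.2).2.1.symm, .inl hab⟩
    · rintro ⟨a, b⟩ hab ⟨c, d⟩ hcd heq
      simp only [Finset.coe_sigma, Set.mem_sigma_iff, Finset.mem_coe] at hab hcd
      rcases Sym2.eq_iff.1 heq with ⟨h1, h2⟩ | ⟨h1, h2⟩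
      · simp only at h1 h2
        subst h1 h2
        rfl
      · simp only at h1
        exact absurd (h1 ▸ hab.1) (hNI _ hcd.1 _ hcd.2)
  have hle := hcount.trans (hd _ _ _ hminor)
  rw [Finset.card_sigma] at hle
  have hge := Finset.card_nsmul_le_sum I (fun a => (N a).card) _ fun v hv =>
    Nat.succ_le_of_lt (hbig v hv)
  rw [smul_eq_mul] at hge
  have hIpos : 0 < I.card := by
    by_contra h0
    have : I.card = 0 := by omega
    rw [this] at hSI
    have := hS.card_pos
    omega
  have h5 : s * M.card ≤ s * ((1 + 2 * r * s) * ((2 * s + 1) * I.card)) :=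
    Nat.mul_le_mul_left _ (hMcard.trans (Nat.mul_le_mul_left _ hSI))
  have h6 : s * ((1 + 2 * r * s) * ((2 * s + 1) * I.card)) =
    I.card * (s * (1 + 2 * r * s) * (2 * s + 1)) := by ring
  have h7 : I.card * (s * (1 + 2 * r * s) * (2 * s + 1)).succ =
    I.card * (s * (1 + 2 * r * s) * (2 * s + 1)) + I.card := by rw [Nat.mul_succ]
  omega

/-! ### Vertex orderings, weak reachability and greedy colouring. -/

/-- If every nonempty set contains a vertex satisfying `Q` with respect to the set, then the
vertices can be ranked so that each one satisfies `Q` with respect to its initial segment. -/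
theorem exists_rank [Finite V] (Q : Finset V → V → Prop)
    (hQ : ∀ S : Finset V, S.Nonempty → ∃ v ∈ S, Q S v) :
    ∃ ρ : V → ℕ, Function.Injective ρ ∧ ∀ v, ∃ S : Finset V, (∀ w, w ∈ S ↔ ρ w ≤ ρ v) ∧ Q S v := by
  classical
  have := Fintype.ofFinite V
  suffices ∀ T : Finset V, ∃ ρ : V → ℕ, Set.InjOn ρ T ∧
      ∀ v ∈ T, Q (T.filter fun w => ρ w ≤ ρ v) v by
    obtain ⟨ρ, h1, h2⟩ := this Finset.univ
    exact ⟨ρ, by simpa using h1, fun v => ⟨_, by simp, h2 v (Finset.mem_univ v)⟩⟩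
  intro T
  induction T using Finset.strongInduction with
  | H T ih =>
    rcases T.eq_empty_or_nonempty with rfl | hT
    · exact ⟨fun _ => 0, by simp⟩
    obtain ⟨v, hv, hQv⟩ := hQ T hT
    obtain ⟨ρ, hinj, hρ⟩ := ih (T.erase v) (Finset.erase_ssubset hv)
    -- The chosen vertex gets the top rank, so its initial segment is all of `T` and the other
    -- segments do not change.
    let k := (T.sup ρ) + 1
    have hk : ∀ w ∈ T, ρ w < k := fun w hw => Nat.lt_succ_of_le (Finset.le_sup (f := ρ) hw)
    have hne : ∀ w, w ≠ v → Function.update ρ v k w = ρ w := fun w hw => by simp [hw]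
    have heq : Function.update ρ v k v = k := by simp
    refine ⟨Function.update ρ v k, ?_, ?_⟩
    · intro a ha b hb hab
      by_cases hav : a = v <;> by_cases hbv : b = v
      · rw [hav, hbv]
      · rw [hav, heq, hne b hbv] at hab
        exact absurd hab.symm (hk b hb).ne
      · rw [hbv, heq, hne a hav] at hab
        exact absurd hab (hk a ha).ne
      · rw [hne a hav, hne b hbv] at hab
        exact hinj (by simpa [hav] using ha) (by simpa [hbv] using hb) hab
    · intro w hw
      by_cases hwv : w = v
      · subst hwv
        rw [heq, Finset.filter_true_of_mem]
        · exact hQv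
        · intro x hx
          by_cases hxw : x = w
          · rw [hxw, heq]
          · rw [hne x hxw]
            exact (hk x hx).le
      · rw [hne w hwv]
        convert hρ w (by simp [hw, hwv]) using 1
        ext x
        by_cases hx : x = v
        · simpa [hx, hv] using hk w hw
        · simp [hx]

/-- The set of vertices weakly `k`-reachable from `v` with respect to the ranking `ρ`. -/
def weakReach (G : SimpleGraph V) (ρ : V → ℕ) (k : ℕ) (v : V) : Set V :=
  {u | WalkIn G (fun z => ρ u ≤ ρ z) k v u}

/-- A walk witnessing weak reachability from `v` ends at a vertex of rank at most that of `v`, so it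
meets the hitting set of `v`. Its remainder is strictly shorter and witnesses weak reachability from
the point met. -/
theorem ncard_weakReach_le [Finite V] {ρ : V → ℕ} {K : ℕ}
    (h : ∀ v, ∃ X, Hits G r {w | ρ w ≤ ρ v} v X ∧ X.card ≤ K) {k : ℕ} (hk : k ≤ r) (v : V) :
    (weakReach G ρ k v).ncard ≤ (K + 1) ^ k := by
  classical
  induction k generalizing v with
  | zero =>
    have : weakReach G ρ 0 v ⊆ {v} := by
      rintro u ⟨p, hp, -⟩
      exact (p.eq_of_length_eq_zero (by omega)).symm
    simpa using Set.ncard_le_ncard this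
  | succ k ih =>
    obtain ⟨X, ⟨hvX, hX⟩, hcard⟩ := h v
    have hsub : weakReach G ρ (k + 1) v ⊆ insert v (⋃ x ∈ X, weakReach G ρ k x) := by
      rintro u ⟨p, hp, hu⟩
      by_cases huv : u = v
      · exact .inl huv
      obtain ⟨x, hx, hxp⟩ := hX u (hu v p.start_mem_support) huv p (by omega)
      refine .inr (Set.mem_iUnion₂.2 ⟨x, hx, p.dropUntil x hxp, ?_, fun z hz =>
        hu z (p.support_dropUntil_subset_support hxp hz)⟩)
      have := SimpleGraph.Walk.length_dropUntil_lt_length hxp (fun h => hvX (h ▸ hx))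
      omega
    have h1 := Set.ncard_le_ncard hsub (Set.toFinite _)
    have h2 := Set.ncard_insert_le v (⋃ x ∈ X, weakReach G ρ k x)
    have h3 : (⋃ x ∈ X, weakReach G ρ k x).ncard ≤ ∑ x ∈ X, (weakReach G ρ k x).ncard :=
      X.set_ncard_biUnion_le _
    have h4 : ∑ x ∈ X, (weakReach G ρ k x).ncard ≤ X.card • (K + 1) ^ k :=
      Finset.sum_le_card_nsmul _ _ _ fun x _ => ih (by omega) x
    have h5 : X.card • (K + 1) ^ k ≤ K * (K + 1) ^ k := Nat.mul_le_mul_right _ hcard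
    have h6 : 1 ≤ (K + 1) ^ k := Nat.one_le_pow _ _ (by omega)
    have h7 : (K + 1) ^ (k + 1) = K * (K + 1) ^ k + (K + 1) ^ k := by ring
    omega

/-- Greedy colouring along a ranking. -/
theorem exists_greedy_coloring [Finite V] {ρ : V → ℕ} (W : V → Set V) {N : ℕ}
    (hv : ∀ v, v ∈ W v) (hW : ∀ v, (W v).ncard ≤ N) :
    ∃ f : V → Fin N, ∀ v, ∀ w ∈ W v, ρ w < ρ v → f w ≠ f v := by
  classical
  have hN : ∀ v : V, 0 < N := fun v =>
    ((Set.ncard_pos (Set.toFinite _)).2 ⟨v, hv v⟩).trans_le (hW v)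
  suffices ∀ n : ℕ, ∃ f : V → Fin N, ∀ v, ρ v < n → ∀ w ∈ W v, ρ w < ρ v → f w ≠ f v by
    obtain ⟨n, hn⟩ := (Set.toFinite (Set.range ρ)).bddAbove
    obtain ⟨f, hf⟩ := this (n + 1)
    exact ⟨f, fun v => hf v (Nat.lt_succ_of_le (hn ⟨v, rfl⟩))⟩
  intro n
  induction n with
  | zero => exact ⟨fun v => ⟨0, hN v⟩, by simp⟩
  | succ n ih =>
    obtain ⟨f, hf⟩ := ih
    -- Since `v ∈ W v`, at most `N - 1` colours are forbidden.
    have hfree : ∀ v, ∃ c : Fin N, c ∉ f '' (W v \ {v}) := fun v => by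
      by_contra! h
      have h1 : f '' (W v \ {v}) = Set.univ := Set.eq_univ_of_forall h
      have h2 := Set.ncard_image_le (f := f) (Set.toFinite (W v \ {v}))
      rw [h1, Set.ncard_univ, Nat.card_fin, Set.ncard_sdiff_singleton_of_mem (hv v)] at h2
      have := hN v
      have := hW v
      omega
    choose c hc using hfree
    refine ⟨fun v => if ρ v = n then c v else f v, fun v hvn w hw hwv => ?_⟩
    have hwn : ρ w ≠ n := by omega
    simp only [hwn, if_false]
    split_ifs with h
    · exact fun heq => hc v ⟨w, ⟨hw, fun h' => hwv.ne (by rw [h'])⟩, heq⟩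
    · exact hf v (by omega) w hw hwv

/-! ### Subcolouring the power. -/

/-- Few weakly `2d`-reachable vertices give a small subchromatic number of the `d`-th power:
cluster the vertices by the least vertex of their ball of radius `⌊d/2⌋`. -/
theorem subColorable_power [Finite V] {d K : ℕ} {ρ : V → ℕ} (hρ : Function.Injective ρ)
    (hW : ∀ v, (weakReach G ρ (2 * d) v).ncard ≤ K) : SubColorable (power G d) K := by
  classical
  obtain ⟨f, hf⟩ := exists_greedy_coloring (ρ := ρ) (weakReach G ρ (2 * d))
    (fun v => .refl le_rfl) hW
  have hc : ∀ v, ∃ c, WalkIn G (fun _ => True) (d / 2) v c ∧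
      ∀ c', WalkIn G (fun _ => True) (d / 2) v c' → ρ c ≤ ρ c' := fun v => by
    obtain ⟨c, hc, hmin⟩ := Set.exists_min_image {c | WalkIn G (fun _ => True) (d / 2) v c} ρ
      (Set.toFinite _) ⟨v, .refl trivial⟩
    exact ⟨c, hc, hmin⟩
  choose c hc hmin using hc
  have hball : ∀ v, WalkIn G (fun z => ρ (c v) ≤ ρ z) (d / 2) v (c v) := fun v =>
    (hc v).strengthen.mono le_rfl fun z hz => hmin v z hz
  have hball' : ∀ v x n, n ≤ d / 2 → WalkIn G (fun _ => True) n v x →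
      WalkIn G (fun z => ρ (c v) ≤ ρ z) n v x := fun v x n hn hx =>
    hx.strengthen.mono le_rfl fun z hz => hmin v z (hz.mono hn fun _ => id)
  have hreach : ∀ u v, (power G d).Adj u v → ρ (c u) < ρ (c v) →
      c u ∈ weakReach G ρ (2 * d) (c v) := by
    intro u v huv hlt
    obtain ⟨p, hp⟩ := SimpleGraph.exists_walk_of_edist_ne_top
      (huv.2.trans_lt (ENat.natCast_lt_top d)).ne
    have hpd : p.length ≤ d := by
      have := huv.2
      rw [← hp] at this
      exact_mod_cast this
    -- Both halves of a path from `u` to `v` lie in the balls of radius `⌊d/2⌋` about their ends, so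
    -- their ranks are at least that of the lower centre. The walk from `c v` through `v` and `u` to
    -- `c u` has length at most `d + 2 * ⌊d/2⌋ ≤ 2 * d`.
    obtain ⟨x, y, q, q', hxy, hq, hq', -⟩ :=
      exists_split_path p.bypass p.bypass_isPath huv.1 (d / 2)
    have hlen := p.length_bypass_le_length
    have h1 := hball' u x _ le_rfl ⟨q, hq, fun _ _ => trivial⟩
    have h2 := hball' v y (d - (d / 2 + 1)) (by omega)
      (WalkIn.symm ⟨q', by omega, fun _ _ => trivial⟩)
    have hle : ∀ z, ρ (c v) ≤ ρ z → ρ (c u) ≤ ρ z := fun z hz => hlt.le.trans hz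
    have h3 := ((hball v).symm.trans h2).mono (Q := fun z => ρ (c u) ≤ ρ z) le_rfl hle
    have h4 := (h3.step hxy.symm h1.right).trans (h1.symm.trans (hball u))
    -- For `d = 0` the truncated subtraction would leave a length bound of `1`; that case is
    -- vacuous.
    by_cases hd : d = 0
    · have : p.length = 0 := by omega
      exact absurd (p.eq_of_length_eq_zero this) huv.1
    exact h4.mono (by omega) fun _ => id
  refine ⟨fun v => f (c v), fun i => ?_⟩
  have hadj : ∀ u v : {v | f (c v) = i}, ((power G d).induce _).Adj u v →
      c u = c v := by
    intro u v huv
    by_contra hne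
    rcases lt_or_gt_of_ne fun h => hne (hρ h) with h | h
    · exact hf _ _ (hreach u v huv h) h (u.2.trans v.2.symm)
    · exact hf _ _ (hreach v u huv.symm h) h (v.2.trans u.2.symm)
  have hwalk : ∀ u v : {v | f (c v) = i}, ((power G d).induce _).Walk u v → c u = c v := by
    intro u v p
    induction p with
    | nil => rfl
    | cons h _ ih => exact (hadj _ _ h).trans ih
  intro C u hu v hv huv
  obtain ⟨p⟩ := SimpleGraph.ConnectedComponent.exact (hu.trans hv.symm)
  have hcu := hwalk u v p
  refine ⟨fun h => huv (Subtype.ext h), ?_⟩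
  obtain ⟨q, hq, -⟩ := (hc u).trans (hcu ▸ (hc v).symm)
  exact (SimpleGraph.Walk.edist_le q).trans (by exact_mod_cast (by omega : q.length ≤ d))

/-- Depth `2 * d` is needed because the colouring uses weak reachability at distance `2 * d`. -/
theorem subColorable_power_of_sparse_minors [Finite V] {d : ℕ}
    (hd : ∀ S H φ, RootedMinor G (2 * d) S H φ → H.edgeSet.ncard ≤ s * S.card) :
    SubColorable (power G d) ((s * (1 + 2 * (2 * d) * s) * (2 * s + 1) + 1) ^ (2 * d)) := by
  obtain ⟨ρ, hρ, h⟩ := exists_rank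
    (fun S v => ∃ X, Hits G (2 * d) S v X ∧ X.card ≤ s * (1 + 2 * (2 * d) * s) * (2 * s + 1))
    fun S hS => exists_hits hd hS
  refine subColorable_power hρ fun v => ncard_weakReach_le (fun w => ?_) le_rfl v
  obtain ⟨S, hS, X, hX, hcard⟩ := h w
  refine ⟨X, ?_, hcard⟩
  convert hX
  ext z
  simp [hS]

/-! ### Transfer to `nabla` and `omega`; the bounded expansion case. -/

theorem RootedMinor.isDepthMinor (h : RootedMinor G r S H φ) :
    IsDepthMinor r (H.induce (S : Set V)) G := by
  let B : ↥(S : Set V) → G.Subgraph := fun a => (⊤ : G.Subgraph).induce {z | φ z = some a.1}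
  have hroot : ∀ a : (S : Set V), a.1 ∈ (B a).verts := fun a => h.root a.1 a.2
  have hdist : ∀ (a : (S : Set V)) (z : (B a).verts), ∃ p : (B a).coe.Walk ⟨a.1, hroot a⟩ z,
      p.length ≤ r := by
    rintro a ⟨z, hz⟩
    obtain ⟨p, hp, hx⟩ := h.reach z a.1 hz
    have key : ∀ (x y : V) (p : G.Walk x y) (hp : ∀ w ∈ p.support, w ∈ (B a).verts),
        ∃ q : (B a).coe.Walk ⟨x, hp x p.start_mem_support⟩ ⟨y, hp y p.end_mem_support⟩,
          q.length = p.length := by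
      intro x y p hp
      induction p with
      | nil => exact ⟨.nil, rfl⟩
      | @cons x w y hxw p ih =>
        obtain ⟨q, hq⟩ := ih fun t ht => hp t (by simp [ht])
        have hadj : (B a).coe.Adj ⟨x, hp x (by simp)⟩ ⟨w, hp w (by simp)⟩ :=
          ⟨hp x (by simp), hp w (by simp), hxw⟩
        exact ⟨.cons hadj q, by simp [hq]⟩
    obtain ⟨q, hq⟩ := key _ _ p hx
    exact ⟨q, hq.trans_le hp⟩
  refine ⟨B, fun a => ⟨?_, ?_⟩, fun a b hab => ?_, fun a b hab => ?_⟩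
  · have : Nonempty (B a).verts := ⟨⟨a.1, hroot a⟩⟩
    refine ⟨fun x y => ?_⟩
    obtain ⟨p, -⟩ := hdist a x
    obtain ⟨q, -⟩ := hdist a y
    exact ⟨p.reverse.append q⟩
  · refine (iInf_le _ ⟨a.1, hroot a⟩).trans ((SimpleGraph.eccent_le_iff _ _).2 fun z => ?_)
    obtain ⟨p, hp⟩ := hdist a z
    exact (SimpleGraph.Walk.edist_le p).trans (by exact_mod_cast hp)
  · rw [Set.disjoint_left]
    intro z hz hz'
    exact hab (Subtype.ext (Option.some.inj (Eq.trans (Eq.symm hz) hz')))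
  · obtain ⟨x, y, hx, hy, hxy⟩ := h.edge _ _ hab
    exact ⟨x, hx, y, hy, hxy⟩

theorem RootedMinor.ncard_edgeSet_induce (h : RootedMinor G r S H φ) :
    (H.induce (S : Set V)).edgeSet.ncard = H.edgeSet.ncard := by
  have : H.edgeSet = Sym2.map Subtype.val '' (H.induce (S : Set V)).edgeSet := by
    ext e
    induction e with
    | _ a b =>
      constructor
      · intro hab
        exact ⟨s(⟨a, h.left_mem a b hab⟩, ⟨b, h.right_mem hab⟩), hab, rfl⟩
      · rintro ⟨e, he, heq⟩
        induction e with
        | _ x y =>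
          rw [← heq]
          exact he
  rw [this, Set.ncard_image_of_injective _ (Sym2.map.injective Subtype.val_injective)]

theorem RootedMinor.ncard_edgeSet_le_of_nabla_le {G : FinGraph.{u}} {H : SimpleGraph G.V}
    {S : Finset G.V} {φ : G.V → Option G.V} (hG : nabla r G ≤ s)
    (h : RootedMinor G.graph r S H φ) : H.edgeSet.ncard ≤ s * S.card := by
  let F : FinGraph.{u} := ⟨(S : Set G.V), inferInstance, H.induce (S : Set G.V)⟩
  have h1 : edgeDensity F ≤ s := (le_iSup₂_of_le (f := fun (H : FinGraph.{u})
    (_ : IsDepthMinor r H.graph G.graph) => edgeDensity H) F h.isDepthMinor le_rfl).trans hG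
  have h2 : Nat.card F.V = S.card := by simp [F]
  have h3 : F.graph.edgeSet.ncard = H.edgeSet.ncard := h.ncard_edgeSet_induce
  rw [edgeDensity, h2, h3] at h1
  rcases Nat.eq_zero_or_pos S.card with h0 | h0
  · have hE : H.edgeSet = ∅ := by
      rw [Finset.card_eq_zero] at h0
      ext e
      induction e with
      | _ a b => simpa [h0] using h.left_mem a b
    simp [hE]
  · have h4 := (ENNReal.div_le_iff (by exact_mod_cast h0.ne') (ENNReal.natCast_ne_top _)).1 h1
    exact_mod_cast h4

theorem RootedMinor.card_le_of_omega_le {G : FinGraph.{u}} {H : SimpleGraph G.V}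
    {S : Finset G.V} {φ : G.V → Option G.V} {t : ℕ} (hG : omega r G ≤ t)
    (h : RootedMinor G.graph r S H φ) (hS : ∀ a ∈ S, ∀ b ∈ S, a ≠ b → H.Adj a b) :
    S.card ≤ t := by
  classical
  let F : FinGraph.{u} := ⟨(S : Set G.V), inferInstance, H.induce (S : Set G.V)⟩
  have h1 : (F.graph.cliqueNum : ℕ∞) ≤ t := (le_iSup₂_of_le (f := fun (H : FinGraph.{u})
    (_ : IsDepthMinor r H.graph G.graph) => (H.graph.cliqueNum : ℕ∞)) F h.isDepthMinor
    le_rfl).trans hG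
  have h2 : F.graph.IsClique (S.attach : Finset F.V) := fun a _ b _ hab =>
    hS a.1 a.2 b.1 b.2 fun h => hab (Subtype.ext h)
  have h3 := h2.card_le_cliqueNum
  rw [Finset.card_attach] at h3
  exact h3.trans (by exact_mod_cast h1)

theorem BoundedExpansion.exists_nabla_le {C : GraphClass.{u}} (hC : BoundedExpansion C) (r : ℕ) :
    ∃ s : ℕ, ∀ G ∈ C, nabla r G ≤ s := by
  obtain ⟨s, hs⟩ := ENNReal.exists_nat_gt (hC r).ne
  exact ⟨s, fun G hG => (le_iSup₂_of_le (f := fun G (_ : G ∈ C) => nabla r G) G hG le_rfl).trans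
    hs.le⟩

theorem NowhereDense.exists_omega_le {C : GraphClass.{u}} (hC : NowhereDense C) (r : ℕ) :
    ∃ t : ℕ, ∀ G ∈ C, omega r G ≤ t := by
  obtain ⟨t, ht⟩ := ENat.ne_top_iff_exists.1 (hC r).ne
  exact ⟨t, fun G hG => (le_iSup₂_of_le (f := fun G (_ : G ∈ C) => omega r G) G hG le_rfl).trans
    ht.ge⟩

theorem chiSub_power_le_of_sparse_minors {G : FinGraph.{u}} {d : ℕ}
    (hd : ∀ S H φ, RootedMinor G.graph (2 * d) S H φ → H.edgeSet.ncard ≤ s * S.card) :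
    chiSub (G.power d) ≤ (s * (1 + 2 * (2 * d) * s) * (2 * s + 1) + 1) ^ (2 * d) :=
  Nat.sInf_le (subColorable_power_of_sparse_minors hd)

theorem BoundedExpansion.chiSubClass_power_lt_top {C : GraphClass.{u}} (hC : BoundedExpansion C)
    (d : ℕ) : chiSubClass (GraphClass.power C d) < ⊤ := by
  obtain ⟨s, hs⟩ := hC.exists_nabla_le (2 * d)
  refine lt_of_le_of_lt (iSup₂_le (a := (((s * (1 + 2 * (2 * d) * s) * (2 * s + 1) + 1) ^ (2 * d) :
    ℕ) : ℕ∞)) ?_) (ENat.natCast_lt_top _)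
  rintro _ ⟨G, hG, rfl⟩
  exact_mod_cast chiSub_power_le_of_sparse_minors fun S H φ h =>
    h.ncard_edgeSet_le_of_nabla_le (hs G hG)

/-! ### Density of shallow minors in nowhere dense classes. -/

open Classical in
theorem exists_subset_minDegree [Finite V] {D : ℝ} (hH : ∀ a b, H.Adj a b → a ∈ S)
    (hS : S.Nonempty) (hD : D * S.card ≤ H.edgeSet.ncard) :
    ∃ T ⊆ S, T.Nonempty ∧ ∀ v ∈ T, D ≤ (T.filter (H.Adj v)).card := by
  induction S using Finset.strongInduction generalizing H with
  | H S ih =>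
    by_cases hdeg : ∀ v ∈ S, D ≤ (S.filter (H.Adj v)).card
    · exact ⟨S, subset_rfl, hS, hdeg⟩
    -- Deleting a vertex of degree below `D` keeps the density at least `D`, strictly, so the
    -- process cannot exhaust `S`.
    push Not at hdeg
    obtain ⟨v, hv, hdeg⟩ := hdeg
    have hsub : H.edgeSet ⊆ (restrict H (S.erase v)).edgeSet ∪
        ↑((S.filter (H.Adj v)).image fun w => s(v, w)) := by
      intro e
      induction e with
      | _ a b =>
        intro hab
        have hab' : H.Adj a b := hab
        by_cases hav : a = v
        · subst hav
          exact .inr (by simpa using ⟨b, ⟨hH b a hab'.symm, hab'⟩, .inl rfl⟩)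
        by_cases hbv : b = v
        · subst hbv
          exact .inr (by simpa using ⟨a, ⟨hH a b hab', hab'.symm⟩, .inr rfl⟩)
        exact .inl ⟨hab', by simp [hav, hH a b hab'], by simp [hbv, hH b a hab'.symm]⟩
    have h1 := (Set.ncard_le_ncard hsub (Set.toFinite _)).trans (Set.ncard_union_le _ _)
    rw [Set.ncard_coe_finset] at h1
    have h2 : H.edgeSet.ncard ≤ (restrict H (S.erase v)).edgeSet.ncard +
        (S.filter (H.Adj v)).card := h1.trans (Nat.add_le_add_left Finset.card_image_le _)
    have h3 : (H.edgeSet.ncard : ℝ) ≤ (restrict H (S.erase v)).edgeSet.ncard +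
        (S.filter (H.Adj v)).card := by exact_mod_cast h2
    have h4 : (S.card : ℝ) = (S.erase v).card + 1 := by
      exact_mod_cast (Finset.card_erase_add_one hv).symm
    rw [h4, mul_add, mul_one] at hD
    have hlt : D * (S.erase v).card < (restrict H (S.erase v)).edgeSet.ncard := by linarith
    have hne : (S.erase v).Nonempty := by
      by_contra hem
      rw [Finset.not_nonempty_iff_eq_empty] at hem
      rw [hem] at hlt
      have : (restrict H (∅ : Finset V)).edgeSet = ∅ := by
        ext e
        induction e with
        | _ a b => simp [restrict]
      simp [this] at hlt
    obtain ⟨T, hT, hTne, hTdeg⟩ := ih (S.erase v) (Finset.erase_ssubset hv)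
      (H := restrict H (S.erase v)) (fun a b hab => hab.2.1) hne hlt.le
    refine ⟨T, hT.trans (Finset.erase_subset _ _), hTne, fun w hw => (hTdeg w hw).trans ?_⟩
    exact_mod_cast Finset.card_le_card (Finset.monotone_filter_right T
      fun x _ (hx : (restrict H (S.erase v)).Adj w x) => hx.1)

open Classical in
/-- In a graph of minimum degree at least `D`, a set of `O(t|T|/D)` vertices contains at least `t`
neighbours of at least half of the vertices. -/
theorem exists_multiply_dominating {D : ℝ} {t : ℕ} (ht : 1 ≤ t) (htD : 2 * t ≤ D)
    (hT : ∀ v ∈ T, D ≤ (T.filter (H.Adj v)).card) :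
    ∃ A ⊆ T, A.card * D ≤ 4 * (t * T.card) ∧
      2 * (T.filter fun v => (A.filter (H.Adj v)).card < t).card ≤ T.card := by
  -- A greedy choice: each vertex of `A` must pay for itself by `D / 4` in the number of neighbours
  -- in `A`, capped at `t` and summed over `T`.
  obtain ⟨A, hA, hmax⟩ := Finset.exists_max_image
    (T.powerset.filter fun A => A.card * D ≤
      4 * (∑ v ∈ T, min t (A.filter (H.Adj v)).card : ℕ)) Finset.card ⟨∅, by simp⟩
  rw [Finset.mem_filter, Finset.mem_powerset] at hA
  obtain ⟨hAT, hA⟩ := hA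
  refine ⟨A, hAT, hA.trans ?_, ?_⟩
  · have : ∑ v ∈ T, min t (A.filter (H.Adj v)).card ≤ T.card • t :=
      Finset.sum_le_card_nsmul _ _ _ fun v _ => min_le_left _ _
    rw [smul_eq_mul, mul_comm] at this
    have : ((∑ v ∈ T, min t (A.filter (H.Adj v)).card : ℕ) : ℝ) ≤ t * T.card := by
      exact_mod_cast this
    linarith
  by_contra! hU
  obtain ⟨U, hUdef⟩ : ∃ U, U = T.filter fun v => (A.filter (H.Adj v)).card < t := ⟨_, rfl⟩
  rw [← hUdef] at hU
  have ht' : (1 : ℝ) ≤ t := by exact_mod_cast ht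
  have hdc : ∑ a ∈ T \ A, (U.filter (H.Adj a)).card = ∑ u ∈ U, ((T \ A).filter (H.Adj u)).card := by
    have := Finset.sum_card_bipartiteAbove_eq_sum_card_bipartiteBelow (s := T \ A) (t := U) H.Adj
    simp only [Finset.bipartiteAbove, Finset.bipartiteBelow] at this
    rw [this]
    refine Finset.sum_congr rfl fun u _ => ?_
    simp only [H.adj_comm u]
  have hlow : ∀ u ∈ U, D - t ≤ (((T \ A).filter (H.Adj u)).card : ℝ) := by
    intro u hu
    rw [hUdef, Finset.mem_filter] at hu
    have h1 := hT u hu.1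
    have h2 : (T.filter (H.Adj u)).card ≤
        ((T \ A).filter (H.Adj u)).card + (A.filter (H.Adj u)).card := by
      rw [← Finset.card_union_of_disjoint]
      · refine Finset.card_le_card fun x => ?_
        simp only [Finset.mem_union, Finset.mem_filter, Finset.mem_sdiff]
        tauto
      · exact (Finset.sdiff_disjoint).mono (Finset.filter_subset _ _) (Finset.filter_subset _ _)
    have h3 : ((T.filter (H.Adj u)).card : ℝ) ≤
        ((T \ A).filter (H.Adj u)).card + (A.filter (H.Adj u)).card := by exact_mod_cast h2
    have h4 : ((A.filter (H.Adj u)).card : ℝ) ≤ t := by exact_mod_cast hu.2.le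
    linarith
  -- If `U` has more than half of `T`, it sends at least `(D - t) * |U| ≥ (D / 2) * |U|` edges to `T
  -- \ A`, so by averaging some vertex there has `D / 4` neighbours in `U` and can be added to `A`.
  obtain ⟨a, ha, hadeg⟩ : ∃ a ∈ T \ A, D / 4 ≤ (U.filter (H.Adj a)).card := by
    by_contra! hcon
    have h1 : ((∑ a ∈ T \ A, (U.filter (H.Adj a)).card : ℕ) : ℝ) ≤ (T \ A).card • (D / 4) := by
      push_cast
      exact Finset.sum_le_card_nsmul _ _ _ fun a ha => (hcon a ha).le
    have h2 : U.card • (D - t) ≤ ((∑ u ∈ U, ((T \ A).filter (H.Adj u)).card : ℕ) : ℝ) := by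
      push_cast
      exact Finset.card_nsmul_le_sum _ _ _ hlow
    rw [hdc] at h1
    rw [nsmul_eq_mul] at h1 h2
    have h3 : ((T \ A).card : ℝ) ≤ T.card := by
      exact_mod_cast Finset.card_le_card Finset.sdiff_subset
    have h4 : (T.card : ℝ) < 2 * U.card := by exact_mod_cast hU
    nlinarith
  rw [Finset.mem_sdiff] at ha
  have hins : (insert a A).card = A.card + 1 := Finset.card_insert_of_notMem ha.2
  have hsum : ∑ v ∈ T, min t (A.filter (H.Adj v)).card + (U.filter (H.Adj a)).card ≤
      ∑ v ∈ T, min t ((insert a A).filter (H.Adj v)).card := by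
    have h1 : (U.filter (H.Adj a)).card = ∑ v ∈ T,
        if (A.filter (H.Adj v)).card < t ∧ H.Adj a v then 1 else 0 := by
      rw [Finset.sum_boole, hUdef, Finset.filter_filter, Nat.cast_id]
    rw [h1, ← Finset.sum_add_distrib]
    refine Finset.sum_le_sum fun v _ => ?_
    have h2 : (A.filter (H.Adj v)).card ≤ ((insert a A).filter (H.Adj v)).card :=
      Finset.card_le_card (Finset.filter_subset_filter _ (Finset.subset_insert _ _))
    split_ifs with h
    · have h3 : ((insert a A).filter (H.Adj v)).card = (A.filter (H.Adj v)).card + 1 := by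
        rw [Finset.filter_insert, if_pos h.2.symm, Finset.card_insert_of_notMem]
        simp [ha.2]
      omega
    · omega
  have := hmax (insert a A) (by
    rw [Finset.mem_filter, Finset.mem_powerset]
    refine ⟨Finset.insert_subset ha.1 hAT, ?_⟩
    have h1 : ((∑ v ∈ T, min t (A.filter (H.Adj v)).card : ℕ) : ℝ) + (U.filter (H.Adj a)).card ≤
      (∑ v ∈ T, min t ((insert a A).filter (H.Adj v)).card : ℕ) := by exact_mod_cast hsum
    rw [hins]
    push_cast at *
    linarith)
  omega

/-- A dense graph without large cliques among its depth-1 minors has a depth-1 minor of comparable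
density on far fewer vertices. -/
theorem exists_smaller_dense_minor [Finite V] {D : ℝ} {t : ℕ} (ht : 1 ≤ t) (htD : 16 * t ≤ D)
    (hH : ∀ a b, H.Adj a b → a ∈ S) (hS : S.Nonempty) (hD : D * S.card ≤ H.edgeSet.ncard)
    (hK : ∀ T H' φ, T ⊆ S → RootedMinor H 1 T H' φ →
      (∀ a ∈ T, ∀ b ∈ T, a ≠ b → H'.Adj a b) → T.card < t) :
    ∃ A H' φ, A ⊆ S ∧ A.Nonempty ∧ RootedMinor H 1 A H' φ ∧
      D * A.card ≤ 16 * t * S.card ∧ D * A.card ≤ 16 * t * H'.edgeSet.ncard := by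
  classical
  have ht' : (1 : ℝ) ≤ t := by exact_mod_cast ht
  obtain ⟨T, hTS, hTne, hT⟩ := exists_subset_minDegree hH hS hD
  obtain ⟨A, hAT, hAcard, hU⟩ := exists_multiply_dominating ht (by linarith) hT
  obtain ⟨H', φ, h, hc, hsat⟩ := exists_saturated_rootedMinor H A (r := 1) (m := 1) (by omega)
  have hTpos : (0 : ℝ) < T.card := by exact_mod_cast hTne.card_pos
  -- If `b` were unlabelled, saturation along paths of length two through `b` would make its `t` or
  -- more neighbours in `A` a clique of the minor. So each such `b` is labelled and is paid for by
  -- an edge of `H'`.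
  have hlab : ∀ b ∈ T, b ∉ A → t ≤ (A.filter (H.Adj b)).card → φ b ≠ none := by
    intro b _ hbA hbt hb
    obtain ⟨ψ, hψ⟩ := h.exists_restrict (T := A.filter (H.Adj b)) (Finset.filter_subset _ _)
    have := hK _ _ _ ((Finset.filter_subset _ _).trans (hAT.trans hTS)) hψ fun x hx y hy hxy => by
      refine ⟨?_, hx, hy⟩
      rw [Finset.mem_filter] at hx hy
      refine hsat x hx.1 y hy.1 hxy ?_
      have h1 : WalkIn H (fun z => z = x ∨ z = y ∨ φ z = none) 1 x b :=
        .adj hx.2.symm (.inl rfl) (.inr (.inr hb))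
      exact h1.step hy.2 (.inr (.inl rfl))
    omega
  have hcount : T.card ≤ H'.edgeSet.ncard + A.card +
      (T.filter fun v => (A.filter (H.Adj v)).card < t).card := by
    have hsub : (T : Set V) ⊆ {z | φ z ≠ none ∧ z ∉ A} ∪
        ↑(A ∪ T.filter fun v => (A.filter (H.Adj v)).card < t) := by
      intro b hb
      by_cases hbA : b ∈ A
      · exact .inr (by simp [hbA])
      by_cases hbt : (A.filter (H.Adj b)).card < t
      · exact .inr (by simpa [hbt] using .inr hb)
      · exact .inl ⟨hlab b hb hbA (by omega), hbA⟩
    have h1 := (Set.ncard_le_ncard hsub (Set.toFinite _)).trans (Set.ncard_union_le _ _)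
    rw [Set.ncard_coe_finset, Set.ncard_coe_finset] at h1
    have h2 := Finset.card_union_le A (T.filter fun v => (A.filter (H.Adj v)).card < t)
    omega
  have h1 : (T.card : ℝ) ≤ H'.edgeSet.ncard + A.card +
      (T.filter fun v => (A.filter (H.Adj v)).card < t).card := by exact_mod_cast hcount
  have h2 : 2 * ((T.filter fun v => (A.filter (H.Adj v)).card < t).card : ℝ) ≤ T.card := by
    exact_mod_cast hU
  -- With `D ≥ 16 * t`, the set `A` takes at most a quarter of `T` and the poorly dominated vertices
  -- at most half, leaving a quarter for the edges of `H'`.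
  have h3 : (A.card : ℝ) * 4 ≤ T.card := by
    have : (A.card : ℝ) * (16 * t) ≤ A.card * D := by gcongr
    nlinarith
  have h4 : (T.card : ℝ) ≤ 4 * H'.edgeSet.ncard := by linarith
  have h5 : (T.card : ℝ) ≤ S.card := by exact_mod_cast Finset.card_le_card hTS
  refine ⟨A, H', φ, hAT.trans hTS, ?_, h, ?_, ?_⟩
  · by_contra hA
    rw [Finset.not_nonempty_iff_eq_empty] at hA
    have hE : H'.edgeSet = ∅ := by
      ext e
      induction e with
      | _ a b => simpa [hA] using h.left_mem a b
    rw [hE, Set.ncard_empty, Nat.cast_zero, mul_zero] at h4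
    linarith
  · nlinarith
  · nlinarith

/-- The depth reached after `k` rounds of taking depth-1 minors of depth-`r` minors. -/
def iterDepth : ℕ → ℕ → ℕ
  | 0, r => r
  | k + 1, r => iterDepth k (3 * r + 1)

theorem le_iterDepth (k r : ℕ) : r ≤ iterDepth k r := by
  induction k generalizing r with
  | zero => exact le_rfl
  | succ k ih => exact le_trans (by omega) (ih (3 * r + 1))

/-- The constant in the bound for the density of minors after `k` rounds. -/
def densityConst (t : ℕ) : ℕ → ℝ
  | 0 => 1
  | k + 1 => densityConst t k * (16 * t) ^ (k + 2)

theorem one_le_densityConst {t : ℕ} (ht : 1 ≤ t) (k : ℕ) : 1 ≤ densityConst t k := by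
  have ht' : (1 : ℝ) ≤ t := by exact_mod_cast ht
  induction k with
  | zero => exact le_rfl
  | succ k ih => exact one_le_mul_of_one_le_of_one_le ih (one_le_pow₀ (by linarith))

/-- Induction on `k`, starting from `D ≤ |S|`. One round replaces `D` by `D / (16 * t)` and `S` by
`A` with `D * |A| ≤ 16 * t * |S|`; multiplying the inductive bound for `A` by `D` raises the
exponent by one. Depth grows from `r` to `3 * r + 1`, as in `iterDepth`. -/
theorem RootedMinor.density_pow_le [Finite V] {t : ℕ} (ht : 1 ≤ t) (k : ℕ)
    (hK : ∀ T H φ, RootedMinor G (iterDepth k r) T H φ →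
      (∀ a ∈ T, ∀ b ∈ T, a ≠ b → H.Adj a b) → T.card < t)
    (h : RootedMinor G r S H φ) (hS : S.Nonempty) {D : ℝ} (hD0 : 0 ≤ D)
    (hD : D * S.card ≤ H.edgeSet.ncard) : D ^ (k + 1) ≤ densityConst t k * S.card := by
  classical
  have ht' : (1 : ℝ) ≤ t := by exact_mod_cast ht
  have hSpos : (1 : ℝ) ≤ S.card := by exact_mod_cast hS.card_pos
  induction k generalizing r S H φ D with
  | zero =>
    have h1 : H.edgeSet ⊆ ↑((S ×ˢ S).image fun x => s(x.1, x.2)) := by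
      intro e
      induction e with
      | _ a b =>
        intro hab
        rw [Finset.mem_coe, Finset.mem_image]
        exact ⟨(a, b), by simp [h.left_mem a b hab, h.right_mem hab], rfl⟩
    have h2 := Set.ncard_le_ncard h1 (Set.toFinite _)
    rw [Set.ncard_coe_finset] at h2
    have h3 := h2.trans Finset.card_image_le
    rw [Finset.card_product] at h3
    have h4 : (H.edgeSet.ncard : ℝ) ≤ S.card * S.card := by exact_mod_cast h3
    simpa [densityConst] using le_of_mul_le_mul_right (hD.trans h4) (by linarith)
  | succ k ih =>
    have hC := one_le_densityConst ht k
    rcases lt_or_ge D (16 * t) with hlt | hge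
    · calc D ^ (k + 1 + 1) ≤ (16 * t) ^ (k + 2) := pow_le_pow_left₀ hD0 hlt.le _
        _ ≤ densityConst t k * (16 * t) ^ (k + 2) := le_mul_of_one_le_left (by positivity) hC
        _ ≤ densityConst t (k + 1) * S.card :=
          le_mul_of_one_le_right (zero_le_one.trans (one_le_densityConst ht (k + 1))) hSpos
    obtain ⟨A, H', ψ, hAS, hA, hψ, hA1, hA2⟩ := exists_smaller_dense_minor ht hge h.left_mem hS hD
      fun T H' ψ hTS hψ hcl => hK T H' _ ((h.comp hψ hTS).mono
        (le_trans (by omega) (le_iterDepth k (3 * r + 1)))) hcl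
    have hApos : (1 : ℝ) ≤ A.card := by exact_mod_cast hA.card_pos
    have h16 : (0 : ℝ) < 16 * t := by linarith
    have h1 := ih hK ((h.comp hψ hAS).mono (by omega : _ ≤ 3 * r + 1)) hA
      (D := D / (16 * t)) (by positivity)
      (by rw [div_mul_eq_mul_div, div_le_iff₀ h16]; linarith) hApos
    rw [div_pow, div_le_iff₀ (by positivity)] at h1
    calc D ^ (k + 1 + 1) = D ^ (k + 1) * D := pow_succ _ _
      _ ≤ densityConst t k * A.card * (16 * t) ^ (k + 1) * D := by gcongr
      _ = densityConst t k * (16 * t) ^ (k + 1) * (D * A.card) := by ring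
      _ ≤ densityConst t k * (16 * t) ^ (k + 1) * (16 * t * S.card) := by gcongr
      _ = densityConst t (k + 1) * S.card := by simp only [densityConst]; ring

/-- The depth-`r` minors of the graphs of a nowhere dense class have density `n^o(1)`. -/
theorem NowhereDense.exists_ncard_edgeSet_le {C : GraphClass.{u}} (hC : NowhereDense C) (r : ℕ)
    {ε : ℝ} (hε : 0 < ε) :
    ∃ c : ℝ, 0 ≤ c ∧ ∀ G ∈ C, ∀ S H φ, RootedMinor G.graph r S H φ →
      (H.edgeSet.ncard : ℝ) ≤ c * (Nat.card G.V : ℝ) ^ ε * S.card := by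
  obtain ⟨k, hk⟩ := exists_nat_one_div_lt hε
  obtain ⟨t, ht⟩ := hC.exists_omega_le (iterDepth k r)
  have hC1 := one_le_densityConst (Nat.le_add_left 1 t) k
  -- `t + 1` turns the bound on clique size into the strict inequality required by `density_pow_le`.
  refine ⟨densityConst (t + 1) k, by linarith, fun G hG S H φ h => ?_⟩
  rcases S.eq_empty_or_nonempty with rfl | hS
  · have hE : H.edgeSet = ∅ := by
      ext e
      induction e with
      | _ a b => simpa using h.left_mem a b
    simp [hE]
  have hSpos : (0 : ℝ) < S.card := by exact_mod_cast hS.card_pos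
  have hSn : (S.card : ℝ) ≤ Nat.card G.V := by
    have := Set.ncard_le_card (S : Set G.V)
    rw [Set.ncard_coe_finset] at this
    exact_mod_cast this
  have hn1 : (1 : ℝ) ≤ Nat.card G.V := le_trans (by exact_mod_cast hS.card_pos) hSn
  have h1 := h.density_pow_le (Nat.le_add_left 1 t) k
    (fun T H φ h hcl => Nat.lt_succ_of_le (h.card_le_of_omega_le (ht G hG) hcl)) hS
    (D := H.edgeSet.ncard / S.card) (by positivity) (by rw [div_mul_cancel₀ _ hSpos.ne'])
  rw [← div_le_iff₀ hSpos]
  refine le_of_pow_le_pow_left₀ (Nat.succ_ne_zero k) (by positivity) (h1.trans ?_)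
  rw [mul_pow]
  refine mul_le_mul (le_self_pow₀ hC1 (Nat.succ_ne_zero k)) ?_ (by positivity) (by positivity)
  refine hSn.trans ?_
  rw [← Real.rpow_natCast, ← Real.rpow_mul (by linarith)]
  refine Real.self_le_rpow_of_one_le hn1 ?_
  have := (div_lt_iff₀ (by positivity)).1 hk
  push_cast
  exact this.le

/-! ### The nowhere dense case. -/

theorem NowhereDense.exists_chiSub_power_le {C : GraphClass.{u}} (hC : NowhereDense C) (d : ℕ)
    {ε : ℝ} (hε : 0 < ε) :
    ∃ c : ℝ, ∀ G ∈ C, (chiSub (G.power d) : ℝ) ≤ c * (Nat.card G.V : ℝ) ^ ε := by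
  -- The bound on the subchromatic number has degree `3 * (2 * d)` in `s`; the extra `1` avoids
  -- division by zero when `d = 0`.
  obtain ⟨e, he⟩ : ∃ e : ℝ, e = ε / (3 * (2 * d) + 1) := ⟨_, rfl⟩
  have he0 : 0 < e := by rw [he]; positivity
  obtain ⟨c, hc0, hc⟩ := hC.exists_ncard_edgeSet_le (2 * d) he0
  refine ⟨((4 + 12 * d) * (c + 1) ^ 3) ^ (2 * d), fun G hG => ?_⟩
  -- On the null graph `0 ^ ε = 0`, so zero colours must suffice.
  rcases Nat.eq_zero_or_pos (Nat.card G.V) with h0 | hpos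
  · have hE : IsEmpty G.V := by
      rcases Nat.card_eq_zero.1 h0 with h | h
      · exact h
      · exact absurd G.finite h.not_finite
    have : chiSub (G.power d) ≤ 0 := Nat.sInf_le ⟨fun v => (hE.false v).elim, fun i => i.elim0⟩
    rw [Nat.le_zero.1 this, Nat.cast_zero]
    positivity
  have hn : (1 : ℝ) ≤ Nat.card G.V := by exact_mod_cast hpos
  obtain ⟨x, hx⟩ : ∃ x : ℝ, x = (Nat.card G.V : ℝ) ^ e := ⟨_, rfl⟩
  have hx1 : 1 ≤ x := hx ▸ Real.one_le_rpow hn he0.le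
  -- Adding `1` to the floor gives both `c * x ≤ s` and `1 ≤ s`; the latter lets every factor be
  -- absorbed into `s ^ 3`.
  obtain ⟨s, hs⟩ : ∃ s : ℕ, s = ⌊c * x⌋₊ + 1 := ⟨_, rfl⟩
  have hs1 : (1 : ℝ) ≤ s := by rw [hs]; push_cast; linarith [Nat.cast_nonneg (α := ℝ) ⌊c * x⌋₊]
  have hsc : c * x ≤ s := by rw [hs]; push_cast; exact (Nat.lt_floor_add_one _).le
  have hsx : (s : ℝ) ≤ (c + 1) * x := by
    have := Nat.floor_le (a := c * x) (by positivity)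
    rw [hs]; push_cast; linarith
  have hχ := chiSub_power_le_of_sparse_minors (G := G) (s := s) (d := d) fun S H φ h => by
    have h1 := hc G hG S H φ h
    rw [← hx] at h1
    have h2 : (H.edgeSet.ncard : ℝ) ≤ s * S.card := h1.trans (by gcongr)
    exact_mod_cast h2
  have hχ' : (chiSub (G.power d) : ℝ) ≤
      (s * (1 + 2 * (2 * d) * s) * (2 * s + 1) + 1) ^ (2 * d) := by exact_mod_cast hχ
  have hbase : (s * (1 + 2 * (2 * d) * s) * (2 * s + 1) + 1 : ℝ) ≤ (4 + 12 * d) * s ^ 3 := by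
    have h1 : (1 + 2 * (2 * d) * s : ℝ) ≤ (1 + 4 * d) * s := by nlinarith
    have h2 : (2 * s + 1 : ℝ) ≤ 3 * s := by linarith
    have h3 : (s * (1 + 2 * (2 * d) * s) * (2 * s + 1) : ℝ) ≤ s * ((1 + 4 * d) * s) * (3 * s) := by
      gcongr
    have h4 : (1 : ℝ) ≤ s ^ 3 := one_le_pow₀ hs1
    nlinarith
  calc (chiSub (G.power d) : ℝ)
      ≤ (s * (1 + 2 * (2 * d) * s) * (2 * s + 1) + 1) ^ (2 * d) := hχ'
    _ ≤ ((4 + 12 * d) * ((c + 1) * x) ^ 3) ^ (2 * d) := by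
      refine pow_le_pow_left₀ (by positivity) (hbase.trans ?_) _
      gcongr
    _ = ((4 + 12 * d) * (c + 1) ^ 3) ^ (2 * d) * x ^ (3 * (2 * d)) := by
      rw [mul_pow (c + 1), ← mul_assoc, mul_pow _ (x ^ 3), ← pow_mul]
    _ ≤ ((4 + 12 * d) * (c + 1) ^ 3) ^ (2 * d) * (Nat.card G.V : ℝ) ^ ε := by
      refine mul_le_mul_of_nonneg_left ?_ (by positivity)
      rw [hx, ← Real.rpow_natCast, ← Real.rpow_mul (by linarith)]
      refine Real.rpow_le_rpow_of_exponent_le hn ?_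
      rw [he, div_mul_eq_mul_div, div_le_iff₀ (by positivity)]
      push_cast
      nlinarith

end SparsePowers

theorem mainTheorem12 :
    (∀ C : SparsePowers.GraphClass.{u}, SparsePowers.NowhereDense C →
      ∀ (d : ℕ) (ε : ℝ), 0 < ε →
        ∃ c : ℝ, ∀ G ∈ C,
          (SparsePowers.chiSub (G.power d) : ℝ) ≤ c * (Nat.card G.V : ℝ) ^ ε) ∧
    (∀ C : SparsePowers.GraphClass.{u}, SparsePowers.BoundedExpansion C →
      ∀ d : ℕ, SparsePowers.chiSubClass (SparsePowers.GraphClass.power C d) < ⊤) :=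
  ⟨fun _ hC d _ hε => hC.exists_chiSub_power_le d hε, fun _ hC d => hC.chiSubClass_power_lt_top d⟩
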